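/- Let $K$ be a field, let $n\ge 2$ and $k\ge 1$ be integers, and let $S=K[x_1,\dots,x_n]$. Let $P_n^k$ be the $k$-th power of the path $P_n$ on the vertices $1,\dots,n$, that is, the simple graph on $\{1,\dots,n\}$ in which $i<j$ are adjacent if and only if their distance in $P_n$ is at most $k$, equivalently $j-i\le k$. Let $I(P_n^k)=(x_ix_j : \{i,j\}\in E(P_n^k))\subset S$ be its edge ideal. Then $$\operatorname{depth}\bigl(S/I(P_n^k)\bigr)=\left\lceil \frac{n}{2k+1}\right\rceil ,$$ where $\operatorname{depth}(M)$ denotes the depth of a finitely generated $S$-module $M$ with respect to the maximal graded ideal $\mathfrak m=(x_1,\dots,x_n)$, i.e. (for $\mathfrak m M\neq M$) the largest length of an $M$-regular sequence of elements of $\mathfrak m$. -/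

import Mathlib

/-- The `k`-th power `G^k` of a simple graph: same vertices, and two distinct vertices are
adjacent iff their distance in `G` is at most `k`. The extended distance is used, so vertices in
different components (at distance `∞`) are never adjacent. -/
def graphPower {V : Type*} (G : SimpleGraph V) (k : ℕ) : SimpleGraph V where
  Adj u v := u ≠ v ∧ G.edist u v ≤ k
  symm := ⟨fun u v h => ⟨h.1.symm, by rw [SimpleGraph.edist_comm]; exact h.2⟩⟩
  loopless := ⟨fun _ h => h.1 rfl⟩

/-- The `k`-th power `P_n^k` of the path on `n` vertices, labelled `0, 1, …, n - 1`. -/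
def pathPower (n k : ℕ) : SimpleGraph (Fin n) :=
  graphPower (SimpleGraph.pathGraph n) k

/-- The edge ideal `I(G) = (x_i x_j : {i, j} ∈ E(G))` in the polynomial ring `K[x_v : v ∈ V]`. -/
noncomputable def edgeIdeal (K : Type*) [Field K] {V : Type*} (G : SimpleGraph V) :
    Ideal (MvPolynomial V K) :=
  Ideal.span {p | ∃ i j : V, G.Adj i j ∧ p = MvPolynomial.X i * MvPolynomial.X j}

/-- The maximal graded ideal `𝔪 = (x_v : v ∈ V)` of the polynomial ring. -/
noncomputable def gradedMaximalIdeal (K : Type*) [Field K] (V : Type*) : Ideal (MvPolynomial V K) :=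
  Ideal.span (Set.range MvPolynomial.X)

/-- The depth of a module `M` with respect to an ideal `J`, for `J M ≠ M`: the supremum of the
lengths of the `M`-regular sequences with all terms in `J`. -/
noncomputable def moduleDepth {R : Type*} [CommRing R] (J : Ideal R)
    (M : Type*) [AddCommGroup M] [Module R M] : ℕ∞ :=
  ⨆ rs : {rs : List R // (∀ r ∈ rs, r ∈ J) ∧ RingTheory.Sequence.IsRegular M rs},
    (rs.1.length : ℕ∞)

/-- The depth of `S / I` as a module over the polynomial ring `S = K[x_v : v ∈ V]`, i.e. its depth
with respect to the maximal graded ideal of `S`. -/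
noncomputable def depthQuotient {K : Type*} [Field K] {V : Type*}
    (I : Ideal (MvPolynomial V K)) : ℕ∞ :=
  moduleDepth (gradedMaximalIdeal K V) (MvPolynomial V K ⧸ I)

/-- Edges of `P_n^k`: for `i < j`, the pair `{i, j}` is an edge iff `j - i ≤ k`. -/
theorem pathPower_adj_of_lt {n k : ℕ} {i j : Fin n} (hij : i < j) :
    (pathPower n k).Adj i j ↔ (j : ℕ) - (i : ℕ) ≤ k := by
  have lower : ∀ {a b : Fin n} (w : (SimpleGraph.pathGraph n).Walk a b),
      (b : ℕ) ≤ a + w.length := by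
    intro a b w
    induction w with
    | nil => simp
    | cons h p ih =>
      rw [SimpleGraph.pathGraph_adj] at h
      rw [SimpleGraph.Walk.length_cons]
      omega
  have upper : ∀ (d : ℕ) (a b : Fin n), (a : ℕ) + d = b →
      ∃ w : (SimpleGraph.pathGraph n).Walk a b, w.length = d := by
    intro d
    induction d with
    | zero =>
      intro a b h
      obtain rfl : a = b := Fin.ext (by simpa using h)
      exact ⟨SimpleGraph.Walk.nil, rfl⟩
    | succ d ih =>
      intro a b h
      have hlt : (a : ℕ) + 1 < n := by have := b.isLt; omega
      obtain ⟨w, hw⟩ := ih ⟨(a : ℕ) + 1, hlt⟩ b (by simp only; omega)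
      have hadj : (SimpleGraph.pathGraph n).Adj a ⟨(a : ℕ) + 1, hlt⟩ := by
        rw [SimpleGraph.pathGraph_adj]; exact Or.inl rfl
      exact ⟨SimpleGraph.Walk.cons hadj w, by rw [SimpleGraph.Walk.length_cons, hw]⟩
  have hij' : (i : ℕ) < j := hij
  change (i ≠ j ∧ (SimpleGraph.pathGraph n).edist i j ≤ k) ↔ _
  obtain ⟨w, hw⟩ := upper ((j : ℕ) - i) i j (by omega)
  constructor
  · rintro ⟨-, h⟩
    obtain ⟨p, hp⟩ := (SimpleGraph.Walk.reachable w).exists_walk_length_eq_edist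
    rw [← hp] at h
    have h1 : p.length ≤ k := by exact_mod_cast h
    have h2 := lower p
    omega
  · intro h
    refine ⟨hij.ne, (SimpleGraph.edist_le w).trans ?_⟩
    rw [hw]
    exact_mod_cast h

/-! Both bounds meet at the least size of a maximal independent set of the graph.

Upper bound: if `A` is maximal independent, the variables outside `A` generate an associated prime
`P` of `S/I` with `dim S/P = |A|`, and depth never exceeds `dim S/P`
(`length_le_ringKrullDim_of_isAssociatedPrime`).

Lower bound (`hasRegularSequence_edgeVarIdeal`): the later neighbours of each vertex form a clique.
Induct on the vertices not yet killed. The variable of an isolated vertex is regular. Otherwise take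
a neighbour `v` of the least remaining vertex and use `0 → S/(I : x_v) → S/I → S/(I + (x_v)) → 0`:
both outer terms have fewer vertices, and their maximal independent sets are still maximal
independent before the deletion.

Counting: a closed neighbourhood in `P_n^k` has at most `2k+1` vertices, and centres of consecutive
blocks of that length attain the resulting bound. -/

open RingTheory.Sequence CategoryTheory Pointwise

/-- `M` admits a regular sequence of length `n` with all terms in `J`. -/
def HasRegularSequence {R : Type*} [CommRing R] (J : Ideal R) (M : Type*) [AddCommGroup M]
    [Module R M] (n : ℕ) : Prop :=
  ∃ rs : List R, rs.length = n ∧ (∀ r ∈ rs, r ∈ J) ∧ IsRegular M rs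

/-! ### Regular sequences and short exact sequences -/

section RegularSequences

universe u

variable {R : Type u} [CommRing R] {J : Ideal R}

theorem HasRegularSequence.cons {M : Type*} [AddCommGroup M] [Module R M] {x : R} {n : ℕ}
    (hx : x ∈ J) (hreg : IsSMulRegular M x) (h : HasRegularSequence J (QuotSMulTop x M) n) :
    HasRegularSequence J M (n + 1) := by
  obtain ⟨rs, hlen, hmem, hrs⟩ := h
  exact ⟨x :: rs, by simp [hlen], by simpa [hx] using hmem, IsRegular.cons hreg hrs⟩

theorem HasRegularSequence.congr {M N : Type*} [AddCommGroup M] [Module R M] [AddCommGroup N]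
    [Module R N] (e : M ≃ₗ[R] N) {n : ℕ} (h : HasRegularSequence J M n) :
    HasRegularSequence J N n := by
  obtain ⟨rs, hlen, hmem, hrs⟩ := h
  exact ⟨rs, hlen, hmem, (e.isRegular_congr rs).mp hrs⟩

theorem HasRegularSequence.zero (M : Type*) [AddCommGroup M] [Module R M] [Nontrivial M] :
    HasRegularSequence J M 0 :=
  ⟨[], rfl, by simp, IsRegular.nil R M⟩

/-- The middle term of a short exact sequence is at least as deep as the shallower outer term. -/
theorem HasRegularSequence.of_exact [IsNoetherianRing R] {A B C : Type u}
    [AddCommGroup A] [Module R A] [Module.Finite R A]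
    [AddCommGroup B] [Module R B] [Module.Finite R B]
    [AddCommGroup C] [Module R C] [Module.Finite R C]
    {f : A →ₗ[R] B} {g : B →ₗ[R] C} (hf : Function.Injective f) (hfg : Function.Exact f g)
    (hg : Function.Surjective g)
    (hA : J • (⊤ : Submodule R A) < ⊤) (hB : J • (⊤ : Submodule R B) < ⊤)
    (hC : J • (⊤ : Submodule R C) < ⊤) {n : ℕ}
    (hAn : HasRegularSequence J A n) (hCn : HasRegularSequence J C n) :
    HasRegularSequence J B n := by
  let S : ShortComplex (ModuleCat.{u} R) :=
    ShortComplex.mk (ModuleCat.ofHom f) (ModuleCat.ofHom g)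
      (by ext x; simpa using hfg.apply_apply_eq_zero x)
  have hS : S.ShortExact :=
    { exact := (ShortComplex.ShortExact.moduleCat_exact_iff_function_exact S).mpr hfg
      mono_f := (ModuleCat.mono_iff_injective _).mpr hf
      epi_g := (ModuleCat.epi_iff_surjective _).mpr hg }
  -- Rees: a regular sequence of length `n` in `J` exists iff `Ext^i(R/J, -)` vanishes for all `i <
  -- n`; the long exact sequence then handles the middle term.
  have extA := ((ModuleCat.exists_isRegular_tfae J n (.of R A) hA).out 1 3).mpr hAn
  have extC := ((ModuleCat.exists_isRegular_tfae J n (.of R C) hC).out 1 3).mpr hCn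
  refine ((ModuleCat.exists_isRegular_tfae J n (.of R B) hB).out 1 3).mp fun i hi => ?_
  have zeroA := AddCommGrpCat.isZero_of_iff_subsingleton.mpr (extA i hi)
  have zeroC := AddCommGrpCat.isZero_of_iff_subsingleton.mpr (extC i hi)
  exact AddCommGrpCat.subsingleton_of_isZero <| ShortComplex.Exact.isZero_of_both_zeros
    (Abelian.Ext.covariant_sequence_exact₂' _ hS i)
    (zeroA.eq_zero_of_src _) (zeroC.eq_zero_of_tgt _)

end RegularSequences

/-! ### Depth is bounded by the dimension of associated primes -/

section AssociatedPrimes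

variable {R : Type*} [CommRing R] [IsNoetherianRing R]

/-- If `x` is a nonzerodivisor on `M`, every associated prime of `M` below a prime `p ∋ x` is
contained in an associated prime of `M / x M` that contains `x` and lies below `p`. -/
theorem exists_isAssociatedPrime_quotSMulTop {M : Type*} [AddCommGroup M] [Module R M]
    [Module.Finite R M] {p P : Ideal R} [p.IsPrime] (hP : IsAssociatedPrime P M) (hPp : P ≤ p)
    {x : R} (hxp : x ∈ p) (hx : IsSMulRegular M x) :
    ∃ Q : Ideal R, IsAssociatedPrime Q (QuotSMulTop x M) ∧ P ≤ Q ∧ x ∈ Q ∧ Q ≤ p := by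
  obtain ⟨-, z₀, hz₀⟩ := (isAssociatedPrime_iff).mp hP
  have hz₀' : ∀ r : R, r ∈ P ↔ r • z₀ = 0 := fun r => by
    rw [hz₀, Submodule.mem_colon_singleton, Submodule.mem_bot]
  let Z : Submodule R M := Submodule.torsionBySet R M P
  have hZ : ∀ z : M, z ∈ Z ↔ ∀ a ∈ P, a • z = 0 := fun z => by
    simp [Z, Submodule.mem_torsionBySet_iff]
  -- `W` is the image in `M/xM` of the elements killed by `P`. Both `P` and `x` annihilate it, so a
  -- minimal prime over its annihilator lying below `p` serves as `Q`.
  let W : Submodule R (QuotSMulTop x M) := Z.map (Submodule.mkQ _)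
  have hW : Module.annihilator R W ≤ p := by
    intro r hr
    let φ : Module.End R Z := algebraMap R (Module.End R Z) r
    have hφ : LinearMap.range φ ≤ Ideal.span {x} • (⊤ : Submodule R Z) := by
      rintro _ ⟨z, rfl⟩
      have h1 : r • (⟨Submodule.mkQ _ z.1, Submodule.mem_map_of_mem z.2⟩ : W) = 0 :=
        Module.mem_annihilator.mp hr _
      have h2 : r • z.1 ∈ x • (⊤ : Submodule R M) := by
        rw [← Submodule.Quotient.mk_eq_zero]
        exact congrArg Subtype.val h1
      -- Since `x` is regular, the quotient `y` is again killed by `P`; hence `r Z ⊆ x Z`.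
      obtain ⟨y, -, hy⟩ := (Submodule.mem_smul_pointwise_iff_exists _ _ _).mp h2
      have hyZ : y ∈ Z := (hZ y).mpr fun a ha => hx <| by
        change x • a • y = x • (0 : M)
        rw [smul_comm, hy, smul_comm, (hZ z.1).mp z.2 a ha, smul_zero, smul_zero]
      rw [Submodule.ideal_span_singleton_smul]
      exact (Submodule.mem_smul_pointwise_iff_exists _ _ _).mpr
        ⟨⟨y, hyZ⟩, trivial, Subtype.ext hy⟩
    -- Cayley–Hamilton: `f` is monic with lower coefficients in `(x)` and `f(r)` kills `z₀`, so
    -- `f(r) ∈ P` and a power of `r` lies in `P + (x) ⊆ p`.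
    obtain ⟨f, hmonic, -, hcoeff, hf⟩ :=
      LinearMap.exists_monic_and_natDegree_eq_and_coeff_mem_pow_and_aeval_eq_zero R φ _ hφ
    have hz₀Z : z₀ ∈ Z := (hZ z₀).mpr fun a ha => (hz₀' a).mp ha
    have hfr : f.eval r ∈ P := by
      rw [hz₀']
      have h3 : (Polynomial.aeval φ f) ⟨z₀, hz₀Z⟩ = 0 := by rw [hf]; rfl
      rw [show Polynomial.aeval φ f = algebraMap R (Module.End R Z) (f.eval r) from
        Polynomial.aeval_algebraMap_apply_eq_algebraMap_eval r f] at h3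
      exact congrArg Subtype.val h3
    rw [Polynomial.eval_eq_sum_range, Finset.sum_range_succ, hmonic.coeff_natDegree,
      one_mul] at hfr
    have hsum : ∑ i ∈ Finset.range f.natDegree, f.coeff i * r ^ i ∈ p := by
      refine Ideal.sum_mem _ fun i hi => Ideal.mul_mem_right _ _ ?_
      refine (Ideal.span_singleton_le_iff_mem p).mpr hxp
        (Ideal.pow_le_self ?_ (hcoeff i))
      have := Finset.mem_range.mp hi
      omega
    exact Ideal.IsPrime.mem_of_pow_mem ‹_› _ ((Ideal.add_mem_iff_right _ hsum).mp (hPp hfr))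
  obtain ⟨Q, hQ, hQp⟩ := Ideal.exists_minimalPrimes_le hW
  refine ⟨Q, IsAssociatedPrime.map_of_injective (f := W.subtype)
    (Module.associatedPrimes.minimalPrimes_annihilator_subset_associatedPrimes R W hQ) W.injective_subtype,
    fun a ha => hQ.1.2 (Module.mem_annihilator.mpr ?_),
    hQ.1.2 (Module.mem_annihilator.mpr ?_), hQp⟩
  · rintro ⟨_, z, hz, rfl⟩
    refine Subtype.ext ?_
    change a • Submodule.mkQ _ z = 0
    rw [← map_smul, (hZ z).mp hz a ha, map_zero]
  · rintro ⟨_, z, hz, rfl⟩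
    refine Subtype.ext ?_
    change x • Submodule.mkQ _ z = 0
    rw [← map_smul]
    exact (Submodule.Quotient.mk_eq_zero _).mpr
      (Submodule.smul_mem_pointwise_smul z x ⊤ trivial)

/-- The depth of `M` is at most the dimension of `R / P` for each associated prime `P` of `M`. -/
theorem length_le_ringKrullDim_of_isAssociatedPrime {p : Ideal R} [p.IsPrime] (rs : List R) :
    ∀ {M : Type*} [AddCommGroup M] [Module R M] [Module.Finite R M] {P : Ideal R}
      (_ : IsAssociatedPrime P M) (_ : P ≤ p) (_ : ∀ r ∈ rs, r ∈ p) (_ : IsWeaklyRegular M rs),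
      (rs.length : WithBot ℕ∞) ≤ ringKrullDim (R ⧸ P) := by
  induction rs with
  | nil =>
    intro M _ _ _ P hP _ _ _
    have := hP.isPrime
    simpa using ringKrullDim_nonneg_of_nontrivial
  | cons x rs ih =>
    intro M _ _ _ P hP hPp hmem hreg
    rw [isWeaklyRegular_cons_iff] at hreg
    obtain ⟨Q, hQ, hPQ, hxQ, hQp⟩ := exists_isAssociatedPrime_quotSMulTop hP hPp
      (hmem x (by simp)) hreg.1
    have hprime := hP.isPrime
    have hxP : x ∉ P := by
      obtain ⟨-, z, rfl⟩ := (isAssociatedPrime_iff).mp hP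
      intro hxz
      have hz : z = 0 := hreg.1 (by simpa [Submodule.mem_colon_singleton] using hxz)
      exact hprime.ne_top (by ext; simp [hz])
    -- `x` lies in `Q` but not in the prime `P`, so the dimension drops at each term of the
    -- sequence.
    have hdim : ringKrullDim (R ⧸ Q) + 1 ≤ ringKrullDim (R ⧸ P) :=
      ringKrullDim_succ_le_of_surjective (Ideal.Quotient.factor hPQ)
        (Ideal.Quotient.factor_surjective hPQ) (r := Ideal.Quotient.mk P x)
        (mem_nonZeroDivisors_of_ne_zero (by rwa [Ne, Ideal.Quotient.eq_zero_iff_mem]))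
        (by simpa [Ideal.Quotient.eq_zero_iff_mem] using hxQ)
    refine le_trans ?_ hdim
    have := ih hQ hQp (fun r hr => hmem r (by simp [hr])) hreg.2
    rw [List.length_cons, Nat.cast_succ]
    gcongr

end AssociatedPrimes


/-! ### Monomial ideals generated by edges and variables -/

section EdgeIdeals

open MvPolynomial

variable {K : Type*} [Field K] {V : Type*}

/-- The ideal generated by the edges of `G` and by the variables indexed by `D`. -/
noncomputable def edgeVarIdeal (K : Type*) [Field K] {V : Type*} (G : SimpleGraph V) (D : Set V) :
    Ideal (MvPolynomial V K) :=
  edgeIdeal K G ⊔ Ideal.span (X '' D)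

/-- The exponents of the monomials lying in `edgeVarIdeal K G D`. -/
def IsEdgeVarExponent (G : SimpleGraph V) (D : Set V) (m : V →₀ ℕ) : Prop :=
  (∃ i j, G.Adj i j ∧ m i ≠ 0 ∧ m j ≠ 0) ∨ ∃ d ∈ D, m d ≠ 0

theorem mem_edgeVarIdeal_iff {G : SimpleGraph V} {D : Set V} {p : MvPolynomial V K} :
    p ∈ edgeVarIdeal K G D ↔ ∀ m ∈ p.support, IsEdgeVarExponent G D m := by
  classical
  let E : Set (V →₀ ℕ) :=
    {s | ∃ i j, G.Adj i j ∧ s = Finsupp.single i 1 + Finsupp.single j 1} ∪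
      (fun d => Finsupp.single d 1) '' D
  have hE : edgeVarIdeal K G D = Ideal.span ((fun s => monomial s (1 : K)) '' E) := by
    rw [edgeVarIdeal, edgeIdeal, ← Ideal.span_union, Set.image_union, Set.image_image]
    congr 2
    ext q
    constructor
    · rintro ⟨i, j, hij, rfl⟩
      exact ⟨_, ⟨i, j, hij, rfl⟩, by simp [X, monomial_mul]⟩
    · rintro ⟨_, ⟨i, j, hij, rfl⟩, rfl⟩
      exact ⟨i, j, hij, by simp [X, monomial_mul]⟩
  rw [hE, mem_ideal_span_monomial_image]
  refine forall₂_congr fun m _ => ⟨?_, ?_⟩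
  · rintro ⟨_, ⟨i, j, hij, rfl⟩ | ⟨d, hd, rfl⟩, hle⟩
    · refine Or.inl ⟨i, j, hij, ?_, ?_⟩
      · have := hle i
        simp only [Finsupp.add_apply, Finsupp.single_eq_same] at this
        omega
      · have := hle j
        simp only [Finsupp.add_apply, Finsupp.single_eq_same] at this
        omega
    · refine Or.inr ⟨d, hd, ?_⟩
      have := hle d
      simp only [Finsupp.single_eq_same] at this
      omega
  · rintro (⟨i, j, hij, hi, hj⟩ | ⟨d, hd, hm⟩)
    · refine ⟨_, Or.inl ⟨i, j, hij, rfl⟩, fun v => ?_⟩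
      have := hij.ne
      simp only [Finsupp.add_apply, Finsupp.single_apply]
      split_ifs <;> grind
    · refine ⟨_, Or.inr ⟨d, hd, rfl⟩, ?_⟩
      simpa [Nat.one_le_iff_ne_zero] using hm

theorem edgeVarIdeal_empty (G : SimpleGraph V) : edgeVarIdeal K G ∅ = edgeIdeal K G := by
  simp [edgeVarIdeal]

theorem edgeVarIdeal_insert (G : SimpleGraph V) (D : Set V) (v : V) :
    edgeVarIdeal K G (insert v D) = edgeVarIdeal K G D ⊔ Ideal.span {X v} := by
  rw [edgeVarIdeal, edgeVarIdeal, Set.image_insert_eq, Ideal.span_insert, sup_assoc,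
    sup_comm (Ideal.span {_})]

theorem monomial_mul_mem_edgeVarIdeal_iff {G : SimpleGraph V} {D : Set V} {s : V →₀ ℕ}
    {p : MvPolynomial V K} :
    monomial s 1 * p ∈ edgeVarIdeal K G D ↔ ∀ m ∈ p.support, IsEdgeVarExponent G D (s + m) := by
  rw [mem_edgeVarIdeal_iff]
  constructor
  · intro h m hm
    refine h _ ?_
    simpa [mem_support_iff, coeff_monomial_mul] using hm
  · intro h m hm
    rw [mem_support_iff, coeff_monomial_mul'] at hm
    split_ifs at hm with hle
    · have := h (m - s) (by simpa using hm)
      rwa [add_tsub_cancel_of_le hle] at this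
    · exact absurd rfl hm

/-- The colon formula `I : x_v = I + (x_w : w ∈ N(v))`. -/
theorem X_mul_mem_edgeVarIdeal_iff {G : SimpleGraph V} {D : Set V} {v : V} (hv : v ∉ D)
    {p : MvPolynomial V K} :
    X v * p ∈ edgeVarIdeal K G D ↔ p ∈ edgeVarIdeal K G (D ∪ G.neighborSet v) := by
  classical
  rw [X, monomial_mul_mem_edgeVarIdeal_iff, mem_edgeVarIdeal_iff]
  refine forall₂_congr fun m _ => ?_
  simp only [IsEdgeVarExponent, Finsupp.add_apply, Finsupp.single_apply, Set.mem_union,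
    SimpleGraph.mem_neighborSet]
  constructor
  · rintro (⟨i, j, hij, hi, hj⟩ | ⟨d, hd, hm⟩)
    · by_cases hvi : v = i
      · subst hvi
        exact Or.inr ⟨j, Or.inr hij, by simpa [hij.ne] using hj⟩
      · by_cases hvj : v = j
        · subst hvj
          exact Or.inr ⟨i, Or.inr hij.symm, by simpa [hvi] using hi⟩
        · exact Or.inl ⟨i, j, hij, by simpa [hvi] using hi, by simpa [hvj] using hj⟩
    · have : v ≠ d := fun h => hv (h ▸ hd)
      exact Or.inr ⟨d, Or.inl hd, by simpa [this] using hm⟩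
  · rintro (⟨i, j, hij, hi, hj⟩ | ⟨d, hd | hd, hm⟩)
    · exact Or.inl ⟨i, j, hij, by omega, by omega⟩
    · exact Or.inr ⟨d, hd, by omega⟩
    · exact Or.inl ⟨v, d, hd, by simp, by omega⟩

theorem edgeVarIdeal_le_gradedMaximalIdeal (G : SimpleGraph V) (D : Set V) :
    edgeVarIdeal K G D ≤ gradedMaximalIdeal K V := by
  refine sup_le (Ideal.span_le.mpr ?_) (Ideal.span_mono (Set.image_subset_range _ _))
  rintro _ ⟨i, j, -, rfl⟩
  exact Ideal.mul_mem_right _ _ (Ideal.subset_span ⟨i, rfl⟩)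

/-- Presents the quotient by the variables outside `A` as the polynomial ring on `A`, which yields
both primality and dimension `|A|`. -/
theorem ker_killCompl_subtype (A : Set V) :
    RingHom.ker (killCompl (R := K) (Subtype.val_injective (p := (· ∈ A)))) =
      Ideal.span (X '' Aᶜ) := by
  classical
  ext p
  rw [RingHom.mem_ker, mem_ideal_span_X_image]
  constructor
  · intro h m hm
    by_contra! hA
    have hrange : (m.support : Set V) ⊆ Set.range (Subtype.val : {v // v ∈ A} → V) := by
      intro v hv
      rw [Subtype.range_val]
      by_contra hvA
      exact (Finsupp.mem_support_iff.mp hv) (hA v hvA)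
    have h0 := congrArg (coeff (m.comapDomain _ Subtype.val_injective.injOn)) h
    rw [coeff_killCompl, Finsupp.mapDomain_comapDomain _ Subtype.val_injective m hrange,
      coeff_zero] at h0
    exact (mem_support_iff.mp hm) h0
  · intro h
    ext s
    rw [coeff_killCompl, coeff_zero]
    by_contra hs
    obtain ⟨v, hv, hsv⟩ := h _ (mem_support_iff.mpr hs)
    exact hsv (Finsupp.mapDomain_of_notMem_range _ _ (by simpa using hv))

theorem span_X_compl_isPrime (A : Set V) :
    (Ideal.span (X '' Aᶜ : Set (MvPolynomial V K))).IsPrime := by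
  rw [← ker_killCompl_subtype]
  exact RingHom.ker_isPrime _

theorem ringKrullDim_quotient_span_X_compl [Finite V] (A : Set V) :
    ringKrullDim (MvPolynomial V K ⧸ Ideal.span (X '' Aᶜ : Set (MvPolynomial V K))) =
      A.ncard := by
  have hsurj : Function.Surjective (killCompl (R := K) (Subtype.val_injective (p := (· ∈ A)))) :=
    fun p => ⟨_, killCompl_rename_app _ p⟩
  rw [← ker_killCompl_subtype, ringKrullDim_eq_of_ringEquiv
    (Ideal.quotientKerAlgEquivOfSurjective hsurj).toRingEquiv,
    MvPolynomial.ringKrullDim_of_isNoetherianRing, ringKrullDim_eq_zero_of_field, zero_add]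
  rfl

theorem gradedMaximalIdeal_isPrime (K : Type*) [Field K] (V : Type*) :
    (gradedMaximalIdeal K V).IsPrime := by
  have := span_X_compl_isPrime (K := K) (∅ : Set V)
  rwa [Set.compl_empty, Set.image_univ] at this

theorem smul_top_quotient_lt_top {R : Type*} [CommRing R] {J I : Ideal R} (hI : I ≤ J)
    (hJ : J ≠ ⊤) : J • (⊤ : Submodule R (R ⧸ I)) < ⊤ := by
  rw [lt_top_iff_ne_top]
  intro h
  have h2 := congrArg (Submodule.comap (Submodule.mkQ I)) h
  rw [Submodule.comap_smul_top_of_surjective J _ (Submodule.mkQ_surjective I)] at h2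
  apply hJ
  simpa [hI] using h2

end EdgeIdeals


/-! ### Independent dominating sets under vertex deletion -/

/-- `B` is an independent dominating (equivalently, maximal independent) set of `G[U]`. -/
structure IsIndepDominating {V : Type*} (G : SimpleGraph V) (U B : Set V) : Prop where
  subset : B ⊆ U
  indep : ∀ a ∈ B, ∀ b ∈ B, ¬ G.Adj a b
  dominating : ∀ u ∈ U, u ∉ B → ∃ b ∈ B, G.Adj u b

section IndepDominating

variable {V : Type*} {G : SimpleGraph V} {D B : Set V} {v : V}

theorem IsIndepDominating.insert_of_isolated (hv : v ∉ D) (hiso : G.neighborSet v ⊆ D)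
    (h : IsIndepDominating G (insert v D)ᶜ B) : IsIndepDominating G Dᶜ (insert v B) := by
  have hB : ∀ b ∈ B, b ≠ v ∧ b ∉ D := fun b hb => by simpa using h.subset hb
  have hadj : ∀ b ∈ B, ¬ G.Adj v b := fun b hb hvb => (hB b hb).2 (hiso hvb)
  refine ⟨?_, ?_, ?_⟩
  · rintro b (rfl | hb)
    exacts [hv, (hB b hb).2]
  · rintro a (rfl | ha) b (rfl | hb)
    exacts [G.irrefl, hadj b hb, fun h => hadj a ha h.symm, h.indep a ha b hb]
  · intro u hu huB
    simp only [Set.mem_insert_iff, not_or] at huB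
    obtain ⟨b, hb, hub⟩ := h.dominating u (by simpa [huB.1] using hu) huB.2
    exact ⟨b, Or.inr hb, hub⟩

/-- Deleting the neighbours of `v` isolates it, which forces `v ∈ B`; then `v` dominates everything
deleted. -/
theorem IsIndepDominating.of_union_neighborSet (hv : v ∉ D)
    (h : IsIndepDominating G (D ∪ G.neighborSet v)ᶜ B) : IsIndepDominating G Dᶜ B := by
  have hvB : v ∈ B := by
    by_contra hvB
    obtain ⟨b, hb, hvb⟩ := h.dominating v (by simp [hv]) hvB
    exact h.subset hb (Or.inr hvb)
  refine ⟨fun b hb hbD => h.subset hb (Or.inl hbD), h.indep, fun u hu huB => ?_⟩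
  by_cases hvu : G.Adj v u
  · exact ⟨v, hvB, hvu.symm⟩
  · exact h.dominating u (by simpa [hvu] using hu) huB

/-- Here `v` is a shedding vertex of `G[Dᶜ]`: it dominates the closed neighbourhood of `s`. -/
theorem IsIndepDominating.of_insert {s : V} (hs : s ∉ D) (hsv : G.Adj s v)
    (hN : ∀ w ∉ D, G.Adj s w → w ≠ v → G.Adj v w)
    (h : IsIndepDominating G (insert v D)ᶜ B) : IsIndepDominating G Dᶜ B := by
  refine ⟨fun b hb hbD => h.subset hb (Or.inr hbD), h.indep, fun u hu huB => ?_⟩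
  by_cases huv : u = v
  · subst huv
    by_cases hsB : s ∈ B
    · exact ⟨s, hsB, hsv.symm⟩
    · obtain ⟨b, hb, hsb⟩ := h.dominating s (by simpa [hsv.ne] using hs) hsB
      have hbD : b ≠ u ∧ b ∉ D := by simpa using h.subset hb
      exact ⟨b, hb, hN b hbD.2 hsb hbD.1⟩
  · exact h.dominating u (by simpa [huv] using hu) huB

end IndepDominating

section Depth

/-! ### Depth bounds for edge ideals -/

open MvPolynomial

/-- `(R / I) / x (R / I)` is `R / (I + (x))`. -/
noncomputable def quotSMulTopQuotientEquiv {R : Type*} [CommRing R] (I : Ideal R) (x : R) :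
    QuotSMulTop x (R ⧸ I) ≃ₗ[R] R ⧸ (I ⊔ Ideal.span {x}) :=
  (Submodule.quotEquivOfEq _ (Submodule.map I.mkQ (Ideal.span {x})) (by
    rw [← Submodule.ideal_span_singleton_smul, ← (Submodule.range_mkQ I), ← Submodule.map_top,
      ← Submodule.map_smul'', Ideal.smul_eq_mul, Ideal.mul_top])).trans
    (Submodule.quotientQuotientEquivQuotientSup I (Ideal.span {x}))

/-- The exact sequence `0 → R / (I : x) → R / I → R / (I + (x)) → 0` bounds depth from below. -/
theorem HasRegularSequence.of_colon {R : Type*} [CommRing R] [IsNoetherianRing R]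
    {J I I' : Ideal R} {x : R} (hJ : J ≠ ⊤) (hI' : ∀ p, x * p ∈ I ↔ p ∈ I') (hI'J : I' ≤ J)
    (hIJ : I ⊔ Ideal.span {x} ≤ J) {n : ℕ} (h₁ : HasRegularSequence J (R ⧸ I') n)
    (h₂ : HasRegularSequence J (R ⧸ (I ⊔ Ideal.span {x})) n) :
    HasRegularSequence J (R ⧸ I) n := by
  let f : (R ⧸ I') →ₗ[R] (R ⧸ I) := Submodule.mapQ I' I (LinearMap.mulLeft R x)
    fun p hp => (hI' p).mpr hp
  let g : (R ⧸ I) →ₗ[R] (R ⧸ (I ⊔ Ideal.span {x})) := Submodule.factor le_sup_left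
  refine HasRegularSequence.of_exact (f := f) (g := g) ?_ ?_ (Submodule.factor_surjective _)
    (smul_top_quotient_lt_top hI'J hJ) (smul_top_quotient_lt_top (le_sup_left.trans hIJ) hJ)
    (smul_top_quotient_lt_top hIJ hJ) h₁ h₂
  · rw [injective_iff_map_eq_zero]
    intro q hq
    obtain ⟨p, rfl⟩ := Submodule.mkQ_surjective I' q
    exact (Submodule.Quotient.mk_eq_zero I').mpr
      ((hI' p).mp ((Submodule.Quotient.mk_eq_zero I).mp hq))
  · intro q
    obtain ⟨p, rfl⟩ := Submodule.mkQ_surjective I q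
    constructor
    · intro hp
      obtain ⟨a, ha, b, hb, hab⟩ :=
        Submodule.mem_sup.mp ((Submodule.Quotient.mk_eq_zero _).mp hp)
      obtain ⟨c, rfl⟩ := Ideal.mem_span_singleton'.mp hb
      refine ⟨Submodule.mkQ I' c, (Submodule.Quotient.eq I).mpr ?_⟩
      have hpc : x * c - p = -a := by
        rw [← show a + c * x = p from hab, mul_comm x c, sub_add_cancel_right]
      exact hpc ▸ neg_mem ha
    · rintro ⟨r, hr⟩
      obtain ⟨c, rfl⟩ := Submodule.mkQ_surjective I' r
      rw [← hr]
      exact (Submodule.Quotient.mk_eq_zero _).mpr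
        (Ideal.mem_sup_right (Ideal.mul_mem_right _ _ (Ideal.mem_span_singleton_self x)))

variable {K : Type*} [Field K] {V : Type*} [Finite V]

/-- For a graph with a perfect elimination ordering, the depth of the edge ideal is at least the
independent domination number. -/
theorem hasRegularSequence_edgeVarIdeal [LinearOrder V] {G : SimpleGraph V}
    (hG : ∀ s v w, s < v → s < w → G.Adj s v → G.Adj s w → w ≠ v → G.Adj v w) (D : Set V) (t : ℕ)
    (ht : ∀ B, IsIndepDominating G Dᶜ B → t ≤ B.ncard) :
    HasRegularSequence (gradedMaximalIdeal K V) (MvPolynomial V K ⧸ edgeVarIdeal K G D) t := by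
  have hprime := gradedMaximalIdeal_isPrime K V
  have hle := edgeVarIdeal_le_gradedMaximalIdeal (K := K) G
  induction hc : Dᶜ.ncard using Nat.strong_induction_on generalizing D t with
  | _ c ih =>
  subst hc
  have hlt : ∀ D' : Set V, D ⊂ D' → D'ᶜ.ncard < Dᶜ.ncard := fun D' h =>
    Set.ncard_lt_ncard (compl_lt_compl_iff_lt.mpr h)
  have hzero : HasRegularSequence (gradedMaximalIdeal K V)
      (MvPolynomial V K ⧸ edgeVarIdeal K G D) 0 := by
    have : Nontrivial (MvPolynomial V K ⧸ edgeVarIdeal K G D) :=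
      Ideal.Quotient.nontrivial_iff.mpr fun h => hprime.ne_top (top_le_iff.mp (h ▸ hle D))
    exact .zero _
  by_cases hiso : ∃ v ∉ D, G.neighborSet v ⊆ D
  · obtain ⟨v, hv, hN⟩ := hiso
    cases t with
    | zero => exact hzero
    | succ t =>
      refine .cons (x := X v) (Ideal.subset_span ⟨v, rfl⟩) ?_ ?_
      · rw [isSMulRegular_quotient_iff_mem_of_smul_mem]
        intro p hp
        have := (X_mul_mem_edgeVarIdeal_iff hv).mp hp
        rwa [Set.union_eq_left.mpr hN] at this
      · refine .congr (quotSMulTopQuotientEquiv _ _).symm ?_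
        rw [← edgeVarIdeal_insert]
        refine ih _ (hlt _ (Set.ssubset_insert hv)) _ _ (fun B hB => ?_) rfl
        have hvB : v ∉ B := fun h => hB.subset h (Set.mem_insert v D)
        have := ht _ (hB.insert_of_isolated hv hN)
        rw [Set.ncard_insert_of_notMem hvB] at this
        omega
  push Not at hiso
  rcases Dᶜ.eq_empty_or_nonempty with hD | hD
  · have : t ≤ (∅ : Set V).ncard := ht ∅ (by rw [hD]; exact ⟨by simp, by simp, by simp⟩)
    rw [Set.ncard_empty, Nat.le_zero] at this
    exact this ▸ hzero
  -- All remaining neighbours of a minimal `s` come later, so they form a clique and any one of them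
  -- is a shedding vertex.
  obtain ⟨s, hs⟩ := (Set.toFinite Dᶜ).exists_minimal hD
  obtain ⟨v, hsv, hv⟩ := Set.not_subset.mp (hiso s hs.1)
  have hmin : ∀ w ∉ D, G.Adj s w → s < w := fun w hw hsw =>
    lt_of_le_of_ne (not_lt.mp fun h => (hs.2 hw h.le).not_gt h) hsw.ne
  refine .of_colon hprime.ne_top (fun p => X_mul_mem_edgeVarIdeal_iff hv) (hle _)
    (edgeVarIdeal_insert (K := K) G D v ▸ hle _) ?_ ?_
  · refine ih _ (hlt _ ⟨Set.subset_union_left, fun h => hs.1 (h (Or.inr hsv.symm))⟩) _ _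
      (fun B hB => ht B (hB.of_union_neighborSet hv)) rfl
  · rw [← edgeVarIdeal_insert]
    exact ih _ (hlt _ (Set.ssubset_insert hv)) _ _ (fun B hB => ht B (hB.of_insert hs.1 hsv
      fun w hw hsw hwv => hG s v w (hmin v hv hsv) (hmin w hw hsw) hsv hsw hwv)) rfl

/-- The variables outside an independent dominating set generate an associated prime. -/
theorem isAssociatedPrime_edgeIdeal {G : SimpleGraph V} {A : Set V}
    (hA : IsIndepDominating G Set.univ A) :
    IsAssociatedPrime (Ideal.span (X '' Aᶜ : Set (MvPolynomial V K)))
      (MvPolynomial V K ⧸ edgeIdeal K G) := by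
  classical
  rw [isAssociatedPrime_iff]
  refine ⟨span_X_compl_isPrime A,
    -- The witness is the product of the variables in `A`: a variable outside `A` completes an edge
    -- with it by domination, while independence keeps monomials in the variables of `A` out of `I`.
    Submodule.mkQ _ (monomial (Finsupp.indicator A.toFinite.toFinset fun _ _ => 1) 1), ?_⟩
  ext p
  rw [Submodule.mem_colon_singleton, Submodule.mem_bot, ← map_smul, Submodule.mkQ_apply,
    Submodule.Quotient.mk_eq_zero, smul_eq_mul, mul_comm, ← edgeVarIdeal_empty,
    monomial_mul_mem_edgeVarIdeal_iff, mem_ideal_span_X_image]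
  refine forall₂_congr fun m _ => ?_
  simp only [IsEdgeVarExponent, Finsupp.add_apply, Finsupp.indicator_apply,
    Set.Finite.mem_toFinset, Set.mem_empty_iff_false, false_and, exists_false, or_false]
  constructor
  · rintro ⟨d, hd, hm⟩
    obtain ⟨a, ha, hda⟩ := hA.dominating d trivial hd
    exact ⟨d, a, hda, by omega, by simp [ha]⟩
  · rintro ⟨i, j, hij, hi, hj⟩
    by_cases hiA : i ∈ A
    · have hjA : j ∉ A := fun hjA => hA.indep i hiA j hjA hij
      exact ⟨j, hjA, by simpa [hjA] using hj⟩
    · exact ⟨i, hiA, by simpa [hiA] using hi⟩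

theorem le_depthQuotient_edgeIdeal [LinearOrder V] {G : SimpleGraph V}
    (hG : ∀ s v w, s < v → s < w → G.Adj s v → G.Adj s w → w ≠ v → G.Adj v w) {t : ℕ}
    (ht : ∀ B, IsIndepDominating G Set.univ B → t ≤ B.ncard) :
    (t : ℕ∞) ≤ depthQuotient (edgeIdeal K G) := by
  obtain ⟨rs, hlen, hmem, hrs⟩ :=
    hasRegularSequence_edgeVarIdeal (K := K) hG ∅ t (by rwa [Set.compl_empty])
  rw [edgeVarIdeal_empty] at hrs
  rw [← hlen]
  exact le_iSup (fun rs : {rs : List (MvPolynomial V K) // (∀ r ∈ rs, r ∈ gradedMaximalIdeal K V) ∧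
    IsRegular (MvPolynomial V K ⧸ edgeIdeal K G) rs} => (rs.1.length : ℕ∞)) ⟨rs, hmem, hrs⟩

theorem depthQuotient_edgeIdeal_le {G : SimpleGraph V} {A : Set V}
    (hA : IsIndepDominating G Set.univ A) :
    depthQuotient (edgeIdeal K G) ≤ A.ncard := by
  have hprime := gradedMaximalIdeal_isPrime K V
  refine iSup_le fun ⟨rs, hmem, hrs⟩ => ?_
  have := length_le_ringKrullDim_of_isAssociatedPrime (p := gradedMaximalIdeal K V) rs
    (isAssociatedPrime_edgeIdeal hA) (Ideal.span_mono (Set.image_subset_range _ _)) hmem hrs.toIsWeaklyRegular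
  rw [ringKrullDim_quotient_span_X_compl] at this
  exact_mod_cast this

end Depth

/-! ### Independent domination in powers of paths -/

section PathPower

variable {n k : ℕ}

theorem pathPower_adj_iff {i j : Fin n} :
    (pathPower n k).Adj i j ↔ i ≠ j ∧ (j : ℕ) ≤ i + k ∧ (i : ℕ) ≤ j + k := by
  rcases lt_trichotomy i j with h | rfl | h
  · rw [pathPower_adj_of_lt h]
    have : (i : ℕ) < j := h
    simp only [h.ne, ne_eq, not_false_eq_true, true_and]
    omega
  · simp
  · rw [SimpleGraph.adj_comm, pathPower_adj_of_lt h]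
    have : (j : ℕ) < i := h
    simp only [h.ne', ne_eq, not_false_eq_true, true_and]
    omega

/-- The closed neighbourhoods of the points of `B` cover all vertices, and each lies in an interval
of `2k+1` integers. -/
theorem IsIndepDominating.le_ncard_mul_pathPower {B : Set (Fin n)}
    (hB : IsIndepDominating (pathPower n k) Set.univ B) : n ≤ B.ncard * (2 * k + 1) := by
  classical
  rw [Set.ncard_eq_toFinset_card B]
  let N : Fin n → Finset (Fin n) := fun b =>
    Finset.univ.filter fun u => (u : ℕ) ≤ b + k ∧ (b : ℕ) ≤ u + k
  have hN : ∀ b ∈ B.toFinite.toFinset, (N b).card ≤ 2 * k + 1 := fun b _ => by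
    have hsub : (N b).image Fin.val ⊆ Finset.Icc (b - k : ℕ) (b + k) := by
      intro u hu
      simp only [N, Finset.mem_image, Finset.mem_filter, Finset.mem_univ, true_and] at hu
      obtain ⟨u, hu, rfl⟩ := hu
      rw [Finset.mem_Icc]
      omega
    have := Finset.card_le_card hsub
    rw [Finset.card_image_of_injective _ Fin.val_injective, Nat.card_Icc] at this
    omega
  have hcover : (Finset.univ : Finset (Fin n)) ⊆ B.toFinite.toFinset.biUnion N := by
    intro u _
    simp only [Finset.mem_biUnion, Set.Finite.mem_toFinset, N, Finset.mem_filter, Finset.mem_univ,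
      true_and]
    by_cases hu : u ∈ B
    · exact ⟨u, hu, by omega, by omega⟩
    · obtain ⟨b, hb, hub⟩ := hB.dominating u trivial hu
      rw [pathPower_adj_iff] at hub
      exact ⟨b, hb, hub.2.2, hub.2.1⟩
  simpa using (Finset.card_le_card hcover).trans (Finset.card_biUnion_le_card_mul _ _ _ hN)

/-- `hq` says `q = ⌈n/(2k+1)⌉` without division: block `j` of length `2k+1` is nonempty iff `j < q`.
The set consists of the block centres. -/
theorem exists_isIndepDominating_pathPower {q : ℕ} (hn : 0 < n)
    (hq : ∀ j, j < q ↔ (2 * k + 1) * j < n) :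
    ∃ A : Set (Fin n), IsIndepDominating (pathPower n k) Set.univ A ∧ A.ncard ≤ q := by
  -- For `j < q` the cap at `n - 1` can only affect the last block; as `n - 1 ≥ (2k+1)j`, its point
  -- still exceeds the earlier centres by more than `k`.
  let c : ℕ → Fin n := fun j => ⟨min ((2 * k + 1) * j + k) (n - 1), by omega⟩
  have hc : ∀ j, (c j : ℕ) = min ((2 * k + 1) * j + k) (n - 1) := fun _ => rfl
  have hfar : ∀ i j, i < j → j < q → ¬ (pathPower n k).Adj (c i) (c j) := by
    intro i j hij hj h
    rw [pathPower_adj_iff, hc, hc] at h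
    have h1 := (hq j).mp hj
    have h2 : (2 * k + 1) * (i + 1) ≤ (2 * k + 1) * j := Nat.mul_le_mul_left _ hij
    rw [mul_add, mul_one] at h2
    omega
  refine ⟨c '' (Finset.range q : Set ℕ), ⟨Set.subset_univ _, ?_, ?_⟩, ?_⟩
  · rintro _ ⟨i, hi, rfl⟩ _ ⟨j, hj, rfl⟩ h
    rw [Finset.mem_coe, Finset.mem_range] at hi hj
    rcases lt_trichotomy i j with hij | rfl | hij
    exacts [hfar i j hij hj h, (pathPower n k).irrefl h, hfar j i hij hi h.symm]
  · intro u _ hu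
    have h1 := Nat.div_add_mod (u : ℕ) (2 * k + 1)
    have h2 := Nat.mod_lt (u : ℕ) (show 0 < 2 * k + 1 by omega)
    have h3 := u.isLt
    have hmem : c (u / (2 * k + 1)) ∈ c '' (Finset.range q : Set ℕ) := by
      refine ⟨_, ?_, rfl⟩
      rw [Finset.mem_coe, Finset.mem_range, hq]
      omega
    refine ⟨_, hmem, pathPower_adj_iff.mpr ⟨fun h => hu (h ▸ hmem), ?_⟩⟩
    rw [hc]
    omega
  · refine (Set.ncard_image_le (Finset.finite_toSet _)).trans ?_
    rw [Set.ncard_coe_finset, Finset.card_range]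

end PathPower

theorem theorem3p9 {K : Type*} [Field K] (n k : ℕ) (hn : 2 ≤ n) (hk : 1 ≤ k) :
    depthQuotient (edgeIdeal K (pathPower n k)) =
      ((⌈(n : ℚ) / (2 * (k : ℚ) + 1)⌉₊ : ℕ) : ℕ∞) := by
  have hpos : (0 : ℚ) < 2 * (k : ℚ) + 1 := by positivity
  apply le_antisymm
  · obtain ⟨A, hA, hcard⟩ := exists_isIndepDominating_pathPower (n := n) (k := k)
      (q := ⌈(n : ℚ) / (2 * (k : ℚ) + 1)⌉₊) (by omega) fun j => by
        rw [Nat.lt_ceil, lt_div_iff₀ hpos, mul_comm]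
        exact_mod_cast Iff.rfl
    exact (depthQuotient_edgeIdeal_le hA).trans (by exact_mod_cast hcard)
  · refine le_depthQuotient_edgeIdeal (fun s v w hsv hsw h₁ h₂ hwv => ?_) fun B hB => ?_
    -- Later neighbours of `s` lie in `(s, s + k]`, so they are within `k` of each other.
    · rw [pathPower_adj_iff] at h₁ h₂ ⊢
      have h₃ : (s : ℕ) < v := hsv
      have h₄ : (s : ℕ) < w := hsw
      exact ⟨hwv.symm, by omega, by omega⟩
    · rw [Nat.ceil_le, div_le_iff₀ hpos]
      exact_mod_cast hB.le_ncard_mul_pathPower
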